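/- Let $n\ge 1$. Let $\sigma^0=I$ and let $\sigma^1,\sigma^2,\sigma^3$ be the Pauli matrices $X,Y,Z$; for $\mathbf a\in\{0,1,2,3\}^n$ put $\sigma^{\mathbf a}=\sigma^{a_1}\otimes\cdots\otimes\sigma^{a_n}$, and let $\sigma^b_j$ denote $\sigma^b$ acting on the $j$th of $n$ qubits. For $\boldsymbol\mu=(\mu_{\mathbf a})_{\mathbf a\neq\mathbf 0}\in\mathbb R^{4^n-1}$ let $H(\boldsymbol\mu)=\sum_{\mathbf a\ne\mathbf 0}\mu_{\mathbf a}\sigma^{\mathbf a}$. For $k\in\{1,\dots,n\}$, $\mathbf s\in\{0,1\}^n$, $\boldsymbol\beta\in\{1,2,3\}^n$ and $\nu\in\mathbb R$ let $$H_{\mathrm{tot}}(\boldsymbol\mu,\nu,k,\mathbf s,\boldsymbol\beta)=H(\boldsymbol\mu)-\nu\Big(\sum_{j\ne k}(-1)^{s_j}\sigma^{\beta_j}_j+\tfrac12(-1)^{s_k}\sigma^{\beta_k}_k\Big),$$ and let $E_\Delta(\boldsymbol\mu,\nu,k,\mathbf s,\boldsymbol\beta)=E_1-E_0$ be the difference of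 its two smallest eigenvalues $E_0\le E_1$ (counted with multiplicity). Collect these gaps in the vector $\mathbf E(\boldsymbol\mu,\nu)=(E_\Delta(\boldsymbol\mu,\nu,k,\mathbf s,\boldsymbol\beta))_{k,\mathbf s,\boldsymbol\beta}\in\mathbb R^{n6^n}$ and define $L(\hat{\mathbf E},\boldsymbol\mu,\nu)=\frac12\|\hat{\mathbf E}-\mathbf E(\boldsymbol\mu,\nu)\|^2$ for $\hat{\mathbf E}\in\mathbb R^{n6^n}$, with $\|\cdot\|$ the Euclidean norm. There exist constants $\nu_0,r_\lambda,c>0$ depending only on $n$ such that the following holds. Let $\boldsymbol\lambda\in\mathbb R^{4^n-1}$ with $|\lambda_{\mathbf a}|\le 1$ for all $\mathbf a\neq\mathbf 0$, let $\nu\ge\nu_0$, let $\|\boldsymbol\mu-\boldsymbol\lambda\|\le r_\lambda$, and let $\|\hat{\mathbf E}-\mathbf E^\star\|\le r_E:=c\,\nu$, where $\mathbf E^\star=\mathbf E(\boldsymbol\lambda,\nu)$. Then $L(\hat{\mathbf E},\cdot,\nu)$ is twice continuously differentiable at $\boldsymbol\mu$, and the smallest eigenvalue of its (symmetric) Hessian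 satisfies $$\lambda_{\min}\Big(\frac{\partial^2L}{\partial\boldsymbol\mu^2}(\hat{\mathbf E},\boldsymbol\mu,\nu)\Big)\ge 2^{n-1}.$$ -/

import Mathlib

open scoped Matrix

noncomputable section

namespace HamLearn

/-- The single-qubit Pauli matrices, `σ⁰ = I`, `σ¹ = X`, `σ² = Y`, `σ³ = Z`. -/
def pauli : Fin 4 → Matrix (Fin 2) (Fin 2) ℂ :=
  ![!![1, 0; 0, 1], !![0, 1; 1, 0], !![0, -Complex.I; Complex.I, 0], !![1, 0; 0, -1]]

/-- Computational basis of `n` qubits, which indexes `2ⁿ × 2ⁿ` matrices. -/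
abbrev Basis (n : ℕ) := Fin n → Fin 2

/-- The Pauli string `σ^a = σ^{a₁} ⊗ ⋯ ⊗ σ^{aₙ}` (entries of a tensor product of matrices are
products of entries). -/
def pauliString {n : ℕ} (a : Fin n → Fin 4) : Matrix (Basis n) (Basis n) ℂ :=
  Matrix.of fun x y => ∏ j, pauli (a j) (x j) (y j)

/-- The operator `σ^b_j`: the Pauli matrix `σ^b` acting on qubit `j` only. -/
def singlePauli {n : ℕ} (j : Fin n) (b : Fin 4) : Matrix (Basis n) (Basis n) ℂ :=
  pauliString (Pi.single j b)

/-- Labels of the coefficients of a traceless Hamiltonian: the nonzero strings in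
`{0,1,2,3}ⁿ`. -/
abbrev CoeffIdx (n : ℕ) := {a : Fin n → Fin 4 // a ≠ 0}

/-- Coefficient vectors, with the Euclidean norm. -/
abbrev Coeffs (n : ℕ) := EuclideanSpace ℝ (CoeffIdx n)

/-- `H(μ) = ∑_{a ≠ 0} μ_a σ^a`. -/
def hamiltonian {n : ℕ} (μ : Coeffs n) : Matrix (Basis n) (Basis n) ℂ :=
  ∑ a : CoeffIdx n, ((μ a : ℝ) : ℂ) • pauliString a.1

/-- Labels `(k, s, β)` of the experiments: `k` a qubit, `s ∈ {0,1}ⁿ`, `β ∈ {1,2,3}ⁿ`. -/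
abbrev ExpIdx (n : ℕ) := Fin n × (Fin n → Fin 2) × (Fin n → {b : Fin 4 // b ≠ 0})

/-- The control Hamiltonian
`H_ctrl(k,s,β) = ∑_{j ≠ k} (-1)^{s_j} σ^{β_j}_j + (1/2) (-1)^{s_k} σ^{β_k}_k`. -/
def ctrlHamiltonian {n : ℕ} (e : ExpIdx n) : Matrix (Basis n) (Basis n) ℂ :=
  (∑ j ∈ Finset.univ.erase e.1,
      (((-1 : ℝ) ^ (e.2.1 j : ℕ) : ℝ) : ℂ) • singlePauli j (e.2.2 j).1)
    + (((1 / 2 : ℝ) * (-1 : ℝ) ^ (e.2.1 e.1 : ℕ) : ℝ) : ℂ) • singlePauli e.1 (e.2.2 e.1).1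

/-- The total Hamiltonian `H_tot(μ,ν,k,s,β) = H(μ) - ν H_ctrl(k,s,β)`. -/
def totalHamiltonian {n : ℕ} (μ : Coeffs n) (ν : ℝ) (e : ExpIdx n) :
    Matrix (Basis n) (Basis n) ℂ :=
  hamiltonian μ - (ν : ℂ) • ctrlHamiltonian e

theorem pauli_isHermitian (b : Fin 4) : (pauli b).IsHermitian := by
  fin_cases b <;> ext i j <;> fin_cases i <;> fin_cases j <;> simp [pauli]

theorem pauliString_isHermitian {n : ℕ} (a : Fin n → Fin 4) : (pauliString a).IsHermitian := by
  ext x y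
  simp only [Matrix.conjTranspose_apply, pauliString, Matrix.of_apply, star_prod]
  exact Finset.prod_congr rfl fun j _ => (pauli_isHermitian (a j)).apply (x j) (y j)

theorem real_smul_isHermitian {m : Type*} (r : ℝ) {A : Matrix m m ℂ} (hA : A.IsHermitian) :
    ((r : ℂ) • A).IsHermitian := by
  rw [Matrix.IsHermitian, Matrix.conjTranspose_smul, hA]
  simp

theorem sum_isHermitian {m ι : Type*} (t : Finset ι) (A : ι → Matrix m m ℂ)
    (hA : ∀ i, (A i).IsHermitian) : (∑ i ∈ t, A i).IsHermitian := by
  rw [Matrix.IsHermitian, Matrix.conjTranspose_sum]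
  exact Finset.sum_congr rfl fun i _ => hA i

theorem totalHamiltonian_isHermitian {n : ℕ} (μ : Coeffs n) (ν : ℝ) (e : ExpIdx n) :
    (totalHamiltonian μ ν e).IsHermitian := by
  refine Matrix.IsHermitian.sub ?_ (real_smul_isHermitian ν (Matrix.IsHermitian.add ?_ ?_))
  · exact sum_isHermitian _ _ fun a => real_smul_isHermitian _ (pauliString_isHermitian _)
  · exact sum_isHermitian _ _ fun a => real_smul_isHermitian _ (pauliString_isHermitian _)
  · exact real_smul_isHermitian _ (pauliString_isHermitian _)

theorem one_lt_card_basis {n : ℕ} (k : Fin n) : 1 < Fintype.card (Basis n) := by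
  have hn : n ≠ 0 := fun h => (Fin.cast h k).elim0
  simpa using Nat.one_lt_two_pow hn

/-- The `i`-th smallest eigenvalue (`i = 0, 1, …`, counted with multiplicity) of a Hermitian
matrix. Mathlib's `eigenvalues₀` lists the eigenvalues in decreasing order. -/
def energy {m : Type*} [Fintype m] [DecidableEq m] {A : Matrix m m ℂ} (hA : A.IsHermitian)
    (i : Fin (Fintype.card m)) : ℝ :=
  hA.eigenvalues₀ i.rev

/-- The energy gap `E_Δ(μ,ν,k,s,β) = E₁ - E₀` between the two lowest eigenvalues of `H_tot`. -/
def energyGap {n : ℕ} (μ : Coeffs n) (ν : ℝ) (e : ExpIdx n) : ℝ :=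
  energy (totalHamiltonian_isHermitian μ ν e) ⟨1, one_lt_card_basis e.1⟩
    - energy (totalHamiltonian_isHermitian μ ν e) ⟨0, zero_lt_one.trans (one_lt_card_basis e.1)⟩

/-- Arrays of energy gaps, as vectors with the Euclidean norm. -/
abbrev Gaps (n : ℕ) := EuclideanSpace ℝ (ExpIdx n)

/-- The array `𝐄(μ,ν)` of all energy gaps. -/
def gapVector {n : ℕ} (μ : Coeffs n) (ν : ℝ) : Gaps n :=
  WithLp.toLp 2 fun e => energyGap μ ν e

/-- The least-squares loss `L(Ê,μ,ν) = ½ ‖Ê - 𝐄(μ,ν)‖²`. -/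
def loss {n : ℕ} (Ehat : Gaps n) (μ : Coeffs n) (ν : ℝ) : ℝ :=
  (1 / 2) * ‖Ehat - gapVector μ ν‖ ^ 2

/-- The Hessian matrix `(∂²f / ∂x_i ∂x_j)(x)` of a function on Euclidean space. -/
def hessian {ι : Type*} [Fintype ι] [DecidableEq ι] (f : EuclideanSpace ℝ ι → ℝ)
    (x : EuclideanSpace ℝ ι) : Matrix ι ι ℝ :=
  Matrix.of fun i j =>
    fderiv ℝ (fun y => fderiv ℝ f y (EuclideanSpace.single j 1)) x (EuclideanSpace.single i 1)

/-- The smallest eigenvalue of a real symmetric matrix (of nonzero size). -/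
def minEigenvalue {ι : Type*} [Fintype ι] [DecidableEq ι] {A : Matrix ι ι ℝ}
    (hA : A.IsHermitian) : ℝ :=
  ⨅ i, hA.eigenvalues i

end HamLearn

end

open scoped Matrix Topology ContDiff

set_option maxSynthPendingDepth 3

noncomputable section

/-! Since H_tot(μ,ν) = ν · H_tot(μ/ν,1), the gaps satisfy E(μ,ν) = ν G(μ/ν), where G is the gap map
at unit control strength. Hence L = ν² · ½‖Ê/ν − G(μ/ν)‖², and the factor ν² cancels the two factors
ν⁻¹ produced by differentiating twice: the Hessian at μ is that of x ↦ ½‖y − G(x)‖² at x = μ/ν, y =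
Ê/ν. For large ν and small c this pair lies near (0, G(0)), so a bound at that single point, with
some slack, suffices.

At x = 0 the operator is −H_ctrl, diagonal in a basis of product states, with simple ground and
first excited levels; the first excited state is the ground state with qubit k flipped. Both
eigenpairs therefore continue smoothly (`exists_smooth_eigenpair`,
`IsLowestPair.exists_smooth_gap`), and first-order perturbation theory gives the Jacobian J of G as
a difference of Pauli expectations.

At (0, G(0)) the residual vanishes, so the Hessian is JᵀJ. The entries of J factor over qubits,
which makes JᵀJ diagonal (`sum_gapJacobian_mul`) with entries at least 4·2ⁿ
(`le_sum_prod_jacobianWeight`). Continuity of the second derivative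
(`exists_leastSquares_snd_lower_bound`) keeps the Hessian above 2ⁿ⁻¹ nearby. -/

namespace HamLearn


/-! ### Two simple lowest eigenvalues of a symmetric operator -/

section LowestPair

variable {V : Type*} [NormedAddCommGroup V] [InnerProductSpace ℂ V]

/-- `t < s` are the two lowest eigenvalues of `T`, both simple, with eigenvectors `v` and `w`. -/
structure IsLowestPair (T : V →ₗ[ℂ] V) (v w : V) (t s : ℝ) : Prop where
  lt : t < s
  left_ne : v ≠ 0
  right_ne : w ≠ 0
  left : T v = (t : ℂ) • v
  right : T w = (s : ℂ) • w
  above : ∀ u, u ≠ 0 → inner ℂ v u = 0 → inner ℂ w u = 0 → s * ‖u‖ ^ 2 < (inner ℂ u (T u)).re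

theorem IsLowestPair.smul {T : V →ₗ[ℂ] V} {v w : V} {t s : ℝ} (h : IsLowestPair T v w t s)
    {r : ℝ} (hr : 0 < r) : IsLowestPair ((r : ℂ) • T) v w (r * t) (r * s) where
  lt := mul_lt_mul_of_pos_left h.lt hr
  left_ne := h.left_ne
  right_ne := h.right_ne
  left := by rw [LinearMap.smul_apply, h.left, smul_smul, Complex.ofReal_mul]
  right := by rw [LinearMap.smul_apply, h.right, smul_smul, Complex.ofReal_mul]
  above u hu hv hw := by
    have := mul_lt_mul_of_pos_left (h.above u hu hv hw) hr
    rw [LinearMap.smul_apply, inner_smul_right, Complex.re_ofReal_mul]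
    linarith

theorem _root_.LinearMap.IsSymmetric.inner_eq_zero_of_apply_eq_smul {T : V →ₗ[ℂ] V}
    (hT : T.IsSymmetric) {u v : V} {a b : ℝ} (hu : T u = (a : ℂ) • u) (hv : T v = (b : ℂ) • v)
    (hab : a ≠ b) : inner ℂ u v = 0 := by
  have h := hT u v
  rw [hu, hv, inner_smul_left, inner_smul_right, Complex.conj_ofReal] at h
  have h2 : ((a : ℂ) - b) * inner ℂ u v = 0 := by linear_combination h
  rcases mul_eq_zero.1 h2 with h3 | h3
  · exact absurd (by exact_mod_cast sub_eq_zero.1 h3) hab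
  · exact h3

theorem re_inner_apply_of_apply_eq_smul {T : V →ₗ[ℂ] V} {u : V} {a : ℝ}
    (hu : T u = (a : ℂ) • u) : (inner ℂ u (T u)).re = a * ‖u‖ ^ 2 := by
  rw [hu, inner_smul_right, inner_self_eq_norm_sq_to_K, Complex.re_ofReal_mul]
  norm_cast

namespace IsLowestPair

variable {T : V →ₗ[ℂ] V} {v w : V} {t s : ℝ}

theorem lt_of_apply_eq_smul (h : IsLowestPair T v w t s) (hT : T.IsSymmetric) {u : V} {a : ℝ}
    (hu : T u = (a : ℂ) • u) (hu0 : u ≠ 0) (ht : a ≠ t) (hs : a ≠ s) : s < a := by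
  have h1 := h.above u hu0 (hT.inner_eq_zero_of_apply_eq_smul h.left hu ht.symm)
    (hT.inner_eq_zero_of_apply_eq_smul h.right hu hs.symm)
  rw [re_inner_apply_of_apply_eq_smul hu] at h1
  exact lt_of_mul_lt_mul_right h1 (by positivity)

theorem eq_zero_of_left (h : IsLowestPair T v w t s) (hT : T.IsSymmetric) {u : V}
    (hu : T u = (t : ℂ) • u) (huv : inner ℂ v u = 0) : u = 0 := by
  by_contra hu0
  have h1 := h.above u hu0 huv (hT.inner_eq_zero_of_apply_eq_smul h.right hu h.lt.ne')
  rw [re_inner_apply_of_apply_eq_smul hu] at h1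
  exact lt_asymm h.lt (lt_of_mul_lt_mul_right h1 (by positivity))

theorem eq_zero_of_right (h : IsLowestPair T v w t s) (hT : T.IsSymmetric) {u : V}
    (hu : T u = (s : ℂ) • u) (huw : inner ℂ w u = 0) : u = 0 := by
  by_contra hu0
  have h1 := h.above u hu0 (hT.inner_eq_zero_of_apply_eq_smul h.left hu h.lt.ne) huw
  rw [re_inner_apply_of_apply_eq_smul hu] at h1
  exact lt_irrefl _ h1

variable [FiniteDimensional ℂ V]

theorem _root_.LinearMap.IsSymmetric.exists_eigenvalues_eq_of_apply_eq_smul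
    (hT : T.IsSymmetric) {N : ℕ} (hN : Module.finrank ℂ V = N) {u : V} {a : ℝ}
    (hu : T u = (a : ℂ) • u) (hu0 : u ≠ 0) : ∃ i, hT.eigenvalues hN i = a := by
  obtain ⟨i, hi⟩ := hT.exists_eigenvalues_eq hN (μ := (a : ℂ))
    (Module.End.hasEigenvalue_of_hasEigenvector (x := u) ⟨Module.End.mem_eigenspace_iff.2 hu, hu0⟩)
  exact ⟨i, Complex.ofReal_injective hi⟩

/-- Links the variational description to the sorted list of eigenvalues, which is decreasing, so
that the lowest ones sit at reversed indices. Both t and s occur in the list, nothing else lies at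
or below s, and t cannot occur twice. -/
theorem eigenvalues_eq (h : IsLowestPair T v w t s) (hT : T.IsSymmetric) {N : ℕ}
    (hN : Module.finrank ℂ V = N) (h1 : 1 < N) :
    hT.eigenvalues hN (Fin.rev ⟨0, zero_lt_one.trans h1⟩) = t ∧
      hT.eigenvalues hN (Fin.rev ⟨1, h1⟩) = s := by
  set i0 : Fin N := Fin.rev ⟨0, zero_lt_one.trans h1⟩ with hi0
  set i1 : Fin N := Fin.rev ⟨1, h1⟩ with hi1
  have hb (i) : T (hT.eigenvectorBasis hN i) = (hT.eigenvalues hN i : ℂ) •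
      hT.eigenvectorBasis hN i := hT.apply_eigenvectorBasis hN i
  have hb0 (i) : hT.eigenvectorBasis hN i ≠ 0 := (hT.eigenvectorBasis hN).orthonormal.ne_zero i
  have hanti := hT.eigenvalues_antitone hN
  have e0 : hT.eigenvalues hN i0 = t := by
    obtain ⟨j, hj⟩ := hT.exists_eigenvalues_eq_of_apply_eq_smul hN h.left h.left_ne
    have hle : hT.eigenvalues hN i0 ≤ t := by
      rw [← hj]
      apply hanti
      rw [Fin.le_def, hi0, Fin.val_rev]
      have := j.2
      simp only
      omega
    by_contra hne
    exact absurd (h.lt_of_apply_eq_smul hT (hb i0) (hb0 i0) hne (by linarith [h.lt] : _ < s).ne)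
      (by linarith [h.lt])
  refine ⟨e0, ?_⟩
  obtain ⟨j, hj⟩ := hT.exists_eigenvalues_eq_of_apply_eq_smul hN h.right h.right_ne
  have hji : j ≠ i0 := by
    rintro rfl
    exact h.lt.ne (e0.symm.trans hj)
  have hle : hT.eigenvalues hN i1 ≤ s := by
    rw [← hj]
    apply hanti
    have h3 : (j : ℕ) ≠ N - 1 := fun h4 => hji (Fin.ext (by rw [hi0, Fin.val_rev]; simpa using h4))
    rw [Fin.le_def, hi1, Fin.val_rev]
    have := j.2
    simp only
    omega
  by_contra hne
  have hi01 : i0 ≠ i1 := by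
    rw [hi0, hi1]
    exact fun h => by simpa using Fin.rev_injective h
  rcases eq_or_ne (hT.eigenvalues hN i1) t with e1 | e1
  · set b0 := hT.eigenvectorBasis hN i0
    set b1 := hT.eigenvectorBasis hN i1
    have hb0' : T b0 = (t : ℂ) • b0 := by rw [hb, e0]
    have hb1' : T b1 = (t : ℂ) • b1 := by rw [hb, e1]
    -- If t occurred twice, this combination of two orthonormal t-eigenvectors would be orthogonal
    -- to v, hence zero by simplicity.
    have hu : (inner ℂ v b1 : ℂ) • b0 - (inner ℂ v b0 : ℂ) • b1 = 0 := by
      refine h.eq_zero_of_left hT ?_ ?_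
      · rw [map_sub, map_smul, map_smul, hb0', hb1', smul_sub, smul_comm (t : ℂ),
          smul_comm (t : ℂ)]
      · simp only [inner_sub_right, inner_smul_right]
        ring
    have hu2 := congrArg (inner ℂ b1) hu
    have h10 : inner ℂ b1 b0 = 0 := (hT.eigenvectorBasis hN).orthonormal.2 hi01.symm
    have h11 : inner ℂ b1 b1 = 1 := by
      rw [inner_self_eq_norm_sq_to_K, (hT.eigenvectorBasis hN).orthonormal.1 i1]
      simp
    simp only [inner_sub_right, inner_smul_right, h10, h11, mul_zero, mul_one, zero_sub,
      inner_zero_right, neg_eq_zero] at hu2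
    exact hb0 i0 (h.eq_zero_of_left hT hb0' hu2)
  · have := h.lt_of_apply_eq_smul hT (hb i1) (hb0 i1) e1 hne
    linarith

end IsLowestPair
end LowestPair

/-! ### Smooth perturbation of simple eigenvalues -/

section Perturbation

variable {V : Type*} [NormedAddCommGroup V] [InnerProductSpace ℂ V] [FiniteDimensional ℂ V]
variable {E : Type*} [NormedAddCommGroup E] [NormedSpace ℝ E]

omit [FiniteDimensional ℂ V] in
theorem _root_.ContDiffAt.clm_restrictScalars_apply (L : E →L[ℝ] (V →L[ℂ] V)) {F : Type*} [NormedAddCommGroup F]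
    [NormedSpace ℝ F] {f : F → E} {g : F → V} {x : F} (hf : ContDiffAt ℝ ∞ f x)
    (hg : ContDiffAt ℝ ∞ g x) : ContDiffAt ℝ ∞ (fun y => L (f y) (g y)) x := by
  have h := ((ContinuousLinearMap.restrictScalarsL ℂ V V ℝ ℝ).comp L).contDiff.contDiffAt.comp x hf
  exact h.clm_apply hg

/-- Implicit function theorem for (T + L x) v = t v with the affine normalization ⟨v₀, v⟩ = 1.
Keeping t complex gives unknowns and equations the same space V × ℂ, so invertibility of the partial
derivative reduces to injectivity, which is the simplicity of t₀. -/
theorem exists_smooth_eigenpair [CompleteSpace E] (T : V →L[ℂ] V)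
    (hT : (T : V →ₗ[ℂ] V).IsSymmetric)
    (L : E →L[ℝ] (V →L[ℂ] V)) {v₀ : V} (hv₀ : ‖v₀‖ = 1) {t₀ : ℝ} (h₀ : T v₀ = (t₀ : ℂ) • v₀)
    (hker : ∀ u, T u = (t₀ : ℂ) • u → inner ℂ v₀ u = 0 → u = 0) :
    ∃ (v : E → V) (t : E → ℂ), ContDiffAt ℝ ∞ v 0 ∧ ContDiffAt ℝ ∞ t 0 ∧ v 0 = v₀ ∧ t 0 = t₀ ∧
      (∀ h, fderiv ℝ t 0 h = inner ℂ v₀ (L h v₀)) ∧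
      ∀ᶠ x in 𝓝 0, (T + L x) (v x) = t x • v x := by
  have : CompleteSpace V := FiniteDimensional.complete ℂ V
  have hv₀' : inner ℂ v₀ v₀ = 1 := by rw [inner_self_eq_norm_sq_to_K, hv₀]; simp
  let f : E × (V × ℂ) → V × ℂ := fun p =>
    (T p.2.1 + L p.1 p.2.1 - p.2.2 • p.2.1, innerSL ℂ v₀ p.2.1 - 1)
  let u : E × (V × ℂ) := (0, (v₀, (t₀ : ℂ)))
  have hTr : ContDiff ℝ ∞ (fun x : V => T x) := (T.restrictScalars ℝ).contDiff
  have hir : ContDiff ℝ ∞ (fun x : V => innerSL ℂ v₀ x) :=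
    ((innerSL ℂ v₀).restrictScalars ℝ).contDiff
  have cdf : ContDiffAt ℝ ∞ f u := by
    refine ContDiffAt.prodMk (((hTr.comp (contDiff_fst.comp contDiff_snd)).contDiffAt.add
      (ContDiffAt.clm_restrictScalars_apply L contDiffAt_fst ?_)).sub ?_) ?_
    · exact (contDiff_fst.comp contDiff_snd).contDiffAt
    · exact ((contDiff_snd.comp contDiff_snd).smul (contDiff_fst.comp contDiff_snd)).contDiffAt
    · exact (hir.comp (contDiff_fst.comp contDiff_snd)).contDiffAt.sub contDiffAt_const
  have pn : (∞ : WithTop ℕ∞) ≠ 0 := by simp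
  have hfu : f u = 0 := by
    simp [f, u, h₀, hv₀]
  have hder : ∀ y : V × ℂ, (fderiv ℝ f u ∘L .inr ℝ E (V × ℂ)) y =
      (T y.1 - (t₀ : ℂ) • y.1 - y.2 • v₀, inner ℂ v₀ y.1) := by
    intro y
    have h1 : HasFDerivAt (fun q : V × ℂ => f (0, q))
        (fderiv ℝ f u ∘L .inr ℝ E (V × ℂ)) (v₀, (t₀ : ℂ)) := by
      have h2 := (cdf.differentiableAt pn).hasFDerivAt
      have h3 : HasFDerivAt (fun q : V × ℂ => ((0 : E), q)) (.inr ℝ E (V × ℂ)) (v₀, (t₀ : ℂ)) :=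
        hasFDerivAt_prodMk_right 0 _
      exact HasFDerivAt.comp (v₀, (t₀ : ℂ)) h2 h3
    have h4 : HasFDerivAt (fun q : V × ℂ => f (0, q))
        ((((T.restrictScalars ℝ).comp (.fst ℝ V ℂ)) -
          ((t₀ : ℂ) • (ContinuousLinearMap.fst ℝ V ℂ) +
            (ContinuousLinearMap.snd ℝ V ℂ).smulRight v₀)).prod
          (((innerSL ℂ v₀).restrictScalars ℝ).comp (.fst ℝ V ℂ))) (v₀, (t₀ : ℂ)) := by
      have h5 : HasFDerivAt (fun q : V × ℂ => T q.1 - q.2 • q.1) _ (v₀, (t₀ : ℂ)) :=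
        (((T.restrictScalars ℝ).comp (.fst ℝ V ℂ)).hasFDerivAt).sub
          (HasFDerivAt.smul (𝕜 := ℝ) (hasFDerivAt_snd) (hasFDerivAt_fst))
      have h6 : HasFDerivAt (fun q : V × ℂ => innerSL ℂ v₀ q.1 - 1) _ (v₀, (t₀ : ℂ)) :=
        (((innerSL ℂ v₀).restrictScalars ℝ).comp (.fst ℝ V ℂ)).hasFDerivAt.sub_const 1
      refine (h5.prodMk h6).congr_of_eventuallyEq (Filter.Eventually.of_forall fun q => ?_)
      simp [f]
    rw [h1.unique h4]
    simp [sub_sub]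
  have hinj : Function.Injective (fderiv ℝ f u ∘L .inr ℝ E (V × ℂ)) := by
    rw [injective_iff_map_eq_zero]
    intro y hy
    rw [hder, Prod.mk_eq_zero] at hy
    obtain ⟨hy1, hy2⟩ := hy
    -- Pairing with v₀ removes (T − t₀)y by symmetry and leaves the increment of t, which must
    -- vanish.
    have h1 := congrArg (inner ℂ v₀) hy1
    have h2 : inner ℂ v₀ (T y.1) = (t₀ : ℂ) * inner ℂ v₀ y.1 := by
      have := hT v₀ y.1
      simp only [ContinuousLinearMap.coe_coe] at this
      rw [← this, h₀, inner_smul_left, Complex.conj_ofReal]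
    simp only [inner_sub_right, inner_smul_right, h2, hy2, hv₀', inner_zero_right] at h1
    have hy3 : y.2 = 0 := by simpa using h1
    rw [hy3, zero_smul, sub_zero, sub_eq_zero] at hy1
    exact Prod.ext (hker _ hy1 hy2) hy3
  have if₂ : (fderiv ℝ f u ∘L .inr ℝ E (V × ℂ)).IsInvertible :=
    ⟨(LinearEquiv.ofInjectiveEndo ((fderiv ℝ f u ∘L .inr ℝ E (V × ℂ)) : (V × ℂ) →ₗ[ℝ] (V × ℂ))
      hinj).toContinuousLinearEquiv, ContinuousLinearMap.ext fun y => rfl⟩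
  let ψ := cdf.implicitFunction pn if₂
  have hψ : ContDiffAt ℝ ∞ ψ 0 := cdf.contDiffAt_implicitFunction pn if₂
  have hψ0 : ψ 0 = (v₀, (t₀ : ℂ)) := cdf.implicitFunction_apply_self pn if₂
  have hev : ∀ᶠ x in 𝓝 0, f (x, ψ x) = f u := cdf.eventually_apply_implicitFunction pn if₂
  have hev1 : ∀ᶠ x in 𝓝 0, (T + L x) (ψ x).1 = (ψ x).2 • (ψ x).1 ∧ inner ℂ v₀ (ψ x).1 = 1 := by
    filter_upwards [hev] with x hx
    rw [hfu, Prod.mk_eq_zero, sub_eq_zero, sub_eq_zero] at hx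
    exact hx
  have hv : ContDiffAt ℝ ∞ (fun x => (ψ x).1) 0 := hψ.fst
  refine ⟨fun x => (ψ x).1, fun x => (ψ x).2, hv, hψ.snd, by simp [hψ0], by simp [hψ0], ?_,
    hev1.mono fun x hx => hx.1⟩
  intro h
  -- Pairing the eigenvalue equation with v₀ expresses t through v. As L 0 = 0, the derivative of v
  -- does not contribute at 0, which yields the first-order formula.
  have heq : (fun x => (ψ x).2) =ᶠ[𝓝 0] fun x => (t₀ : ℂ) + innerSL ℂ v₀ (L x (ψ x).1) := by
    filter_upwards [hev1] with x hx
    have h1 := congrArg (inner ℂ v₀) hx.1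
    have h2 : inner ℂ v₀ (T (ψ x).1) = (t₀ : ℂ) * inner ℂ v₀ (ψ x).1 := by
      have := hT v₀ (ψ x).1
      simp only [ContinuousLinearMap.coe_coe] at this
      rw [← this, h₀, inner_smul_left, Complex.conj_ofReal]
    rw [add_apply, inner_add_right, h2, inner_smul_right, hx.2] at h1
    simp only [innerSL_apply_apply]
    linear_combination -h1
  rw [heq.fderiv_eq]
  have hd1 : HasFDerivAt (fun x => L x (ψ x).1) _ 0 :=
    (((ContinuousLinearMap.restrictScalarsL ℂ V V ℝ ℝ).comp L).hasFDerivAt (x := 0)).clm_apply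
      (hv.differentiableAt pn).hasFDerivAt
  have hd2 := (((innerSL ℂ v₀).restrictScalars ℝ).hasFDerivAt.comp 0 hd1).const_add (t₀ : ℂ)
  have hd3 : HasFDerivAt (fun x => (t₀ : ℂ) + innerSL ℂ v₀ (L x (ψ x).1)) _ 0 := hd2
  rw [hd3.fderiv]
  simp [hψ0]


/-- Continuing both eigenpairs is not enough: they must also remain the two lowest. That is an open
condition because the unit sphere is compact. -/
theorem IsLowestPair.exists_smooth_gap [CompleteSpace E] {T : V →L[ℂ] V}
    {L : E →L[ℝ] (V →L[ℂ] V)} (hTL : ∀ x, ((T + L x : V →L[ℂ] V) : V →ₗ[ℂ] V).IsSymmetric)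
    {v₀ w₀ : V} {t₀ s₀ : ℝ} (h : IsLowestPair (T : V →ₗ[ℂ] V) v₀ w₀ t₀ s₀)
    (hv₀ : ‖v₀‖ = 1) (hw₀ : ‖w₀‖ = 1) :
    ∃ g : E → ℝ, ContDiffAt ℝ ∞ g 0 ∧
      (∀ y, fderiv ℝ g 0 y = (inner ℂ w₀ (L y w₀)).re - (inner ℂ v₀ (L y v₀)).re) ∧
      ∀ᶠ x in 𝓝 0, ∃ (v w : V) (t s : ℝ),
        IsLowestPair ((T + L x : V →L[ℂ] V) : V →ₗ[ℂ] V) v w t s ∧ g x = s - t := by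
  have : ProperSpace V := FiniteDimensional.proper ℂ V
  have hT : (T : V →ₗ[ℂ] V).IsSymmetric := by simpa using hTL 0
  have pn : (∞ : WithTop ℕ∞) ≠ 0 := by simp
  obtain ⟨v, t, hv, ht, hv0, ht0, hdt, hvt⟩ := exists_smooth_eigenpair T hT L hv₀ h.left
    fun u => h.eq_zero_of_left hT
  obtain ⟨w, s, hw, hs, hw0, hs0, hds, hws⟩ := exists_smooth_eigenpair T hT L hw₀ h.right
    fun u => h.eq_zero_of_right hT
  have htr : ContDiffAt ℝ ∞ (fun x => (t x).re) 0 := Complex.reCLM.contDiff.contDiffAt.comp 0 ht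
  have hsr : ContDiffAt ℝ ∞ (fun x => (s x).re) 0 := Complex.reCLM.contDiff.contDiffAt.comp 0 hs
  have hdre {q : E → ℂ} (hq : ContDiffAt ℝ ∞ q 0) (y : E) :
      fderiv ℝ (fun x => (q x).re) 0 y = (fderiv ℝ q 0 y).re := by
    have := (Complex.reCLM.hasFDerivAt.comp 0 (hq.differentiableAt pn).hasFDerivAt).fderiv
    exact congrArg (fun l => l y) this
  refine ⟨fun x => (s x).re - (t x).re, hsr.sub htr, ?_, ?_⟩
  · intro y
    rw [fderiv_fun_sub (hsr.differentiableAt pn) (htr.differentiableAt pn)]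
    simp only [sub_apply, hdre hs, hdre ht, hdt, hds]
  have hlt : ∀ᶠ x in 𝓝 0, (t x).re < (s x).re :=
    htr.continuousAt.eventually_lt hsr.continuousAt (by simpa [ht0, hs0] using h.lt)
  have hvne : ∀ᶠ x in 𝓝 0, v x ≠ 0 := hv.continuousAt.eventually_ne (by rw [hv0]; exact h.left_ne)
  have hwne : ∀ᶠ x in 𝓝 0, w x ≠ 0 := hw.continuousAt.eventually_ne (by rw [hw0]; exact h.right_ne)
  have hreal {q : E → ℂ} {z : E → V} {x : E} (hz : z x ≠ 0)
      (hq : (T + L x) (z x) = q x • z x) : q x = ((q x).re : ℂ) := by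
    have := (hTL x).conj_eigenvalue_eq_self
      (Module.End.hasEigenvalue_of_hasEigenvector ⟨Module.End.mem_eigenspace_iff.2 hq, hz⟩)
    exact (Complex.conj_eq_iff_re.1 this).symm
  -- Locally in u, either an orthogonality condition fails at x = 0, and so nearby, making the claim
  -- vacuous, or both hold and the strict inequality persists.
  have hgap : ∀ᶠ x in 𝓝 0, ∀ u ∈ Metric.sphere (0 : V) 1, inner ℂ (v x) u = 0 →
      inner ℂ (w x) u = 0 → (s x).re < (inner ℂ u ((T + L x) u)).re := by
    refine (isCompact_sphere (0 : V) 1).eventually_forall_of_forall_eventually fun u hu => ?_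
    have hin {z : E → V} (hz : ContinuousAt z 0) :
        ContinuousAt (fun p : E × V => (inner ℂ (z p.1) p.2 : ℂ)) (0, u) :=
      ContinuousAt.inner hz.fst' continuousAt_snd
    by_cases hvu : inner ℂ v₀ u = 0
    · by_cases hwu : inner ℂ w₀ u = 0
      · have hu0 : u ≠ 0 := ne_zero_of_mem_unit_sphere ⟨u, hu⟩
        have h1 := h.above u hu0 hvu hwu
        have hc : ContinuousAt (fun p : E × V => (inner ℂ p.2 ((T + L p.1) p.2)).re) (0, u) :=
          Complex.continuous_re.continuousAt.comp
            (ContinuousAt.inner continuousAt_snd (by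
              refine ContinuousAt.clm_apply ?_ continuousAt_snd
              exact (continuous_const.add (L.continuous.comp continuous_fst)).continuousAt))
        have hc2 : ContinuousAt (fun p : E × V => (s p.1).re) (0, u) := hsr.continuousAt.fst'
        refine (hc2.eventually_lt hc ?_).mono fun p hp _ _ => hp
        rw [mem_sphere_zero_iff_norm] at hu
        simpa [hs0, hu] using h1
      · exact ((hin hw.continuousAt).eventually_ne (by simpa [hw0] using hwu)).mono
          fun p hp _ h2 => absurd h2 hp
    · exact ((hin hv.continuousAt).eventually_ne (by simpa [hv0] using hvu)).mono
        fun p hp h1 => absurd h1 hp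
  filter_upwards [hlt, hvne, hwne, hvt, hws, hgap] with x h1 h2 h3 h4 h5 h6
  refine ⟨v x, w x, (t x).re, (s x).re, ⟨h1, h2, h3, ?_, ?_, ?_⟩, rfl⟩
  · rw [← hreal h2 h4]
    exact h4
  · rw [← hreal h3 h5]
    exact h5
  · intro u hu hvu hwu
    have hn : 0 < ‖u‖ := norm_pos_iff.2 hu
    have h7 := h6 (((‖u‖⁻¹ : ℝ) : ℂ) • u) (by
      rw [mem_sphere_zero_iff_norm, norm_smul, Complex.norm_real, norm_inv, norm_norm,
        inv_mul_cancel₀ hn.ne']) (by rw [inner_smul_right, hvu, mul_zero])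
      (by rw [inner_smul_right, hwu, mul_zero])
    rw [map_smul, inner_smul_left, inner_smul_right, Complex.conj_ofReal, Complex.re_ofReal_mul,
      Complex.re_ofReal_mul] at h7
    rw [ContinuousLinearMap.coe_coe]
    have h8 := mul_lt_mul_of_pos_right h7 (pow_pos hn 2)
    calc _ < _ := h8
      _ = _ := by field_simp

end Perturbation


/-! ### Hessian matrix and second derivative -/

section Hessian

variable {ι : Type*} [Fintype ι] [DecidableEq ι]

theorem hessian_apply {f : EuclideanSpace ℝ ι → ℝ} {x : EuclideanSpace ℝ ι}
    (hf : ContDiffAt ℝ 2 f x) (i j : ι) :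
    hessian f x i j =
      fderiv ℝ (fderiv ℝ f) x (EuclideanSpace.single i 1) (EuclideanSpace.single j 1) := by
  have hd : DifferentiableAt ℝ (fderiv ℝ f) x :=
    (hf.fderiv_right (m := 1) (by norm_num)).differentiableAt (by norm_num)
  rw [hessian, Matrix.of_apply, fderiv_clm_apply hd (differentiableAt_const _)]
  simp

theorem hessian_isHermitian {f : EuclideanSpace ℝ ι → ℝ} {x : EuclideanSpace ℝ ι}
    (hf : ContDiffAt ℝ 2 f x) : (hessian f x).IsHermitian := by
  refine Matrix.IsHermitian.ext fun i j => ?_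
  rw [hessian_apply hf, hessian_apply hf, star_trivial]
  exact (hf.isSymmSndFDerivAt (by simp)).eq _ _

theorem dotProduct_hessian_mulVec {f : EuclideanSpace ℝ ι → ℝ} {x : EuclideanSpace ℝ ι}
    (hf : ContDiffAt ℝ 2 f x) (v : EuclideanSpace ℝ ι) :
    v.ofLp ⬝ᵥ (hessian f x *ᵥ v.ofLp) = fderiv ℝ (fderiv ℝ f) x v v := by
  have hv : v = ∑ i, v i • EuclideanSpace.single i (1 : ℝ) := by
    ext j
    simp [Pi.single_apply]
  conv_rhs => rw [hv]
  simp only [map_sum, map_smul, sum_apply, smul_apply, smul_eq_mul,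
    dotProduct, Matrix.mulVec, hessian_apply hf, Finset.mul_sum]
  rw [Finset.sum_comm]
  exact Finset.sum_congr rfl fun i _ => Finset.sum_congr rfl fun j _ => by ring

/-- Each eigenvalue is the value of the quadratic form at a unit eigenvector. -/
theorem le_minEigenvalue_hessian [Nonempty ι] {f : EuclideanSpace ℝ ι → ℝ}
    {x : EuclideanSpace ℝ ι} (hf : ContDiffAt ℝ 2 f x) {c : ℝ}
    (hc : ∀ v, c * ‖v‖ ^ 2 ≤ fderiv ℝ (fderiv ℝ f) x v v) :
    c ≤ minEigenvalue (hessian_isHermitian hf) := by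
  refine le_ciInf fun i => ?_
  have h := hc ((hessian_isHermitian hf).eigenvectorBasis i)
  rw [← dotProduct_hessian_mulVec hf,
    (hessian_isHermitian hf).eigenvectorBasis.orthonormal.1 i] at h
  rw [Matrix.IsHermitian.eigenvalues_eq]
  simpa using h

end Hessian

/-! ### Curvature of a least-squares loss -/

section LeastSquares

variable {E : Type*} [NormedAddCommGroup E] [NormedSpace ℝ E] {κ : Type*} [Fintype κ]

/-- The second derivative of `x ↦ ½ ∑ₑ (yₑ - gₑ(x))²`. -/
def leastSquaresSnd (g : κ → E → ℝ) (x : E) (y : EuclideanSpace ℝ κ) : E →L[ℝ] E →L[ℝ] ℝ :=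
  ∑ e, ((g e x - y e) • fderiv ℝ (fderiv ℝ (g e)) x +
    (fderiv ℝ (g e) x).smulRight (fderiv ℝ (g e) x))

theorem leastSquares_fderiv_fderiv {g : κ → E → ℝ} {x : E} (hg : ∀ e, ContDiffAt ℝ 2 (g e) x)
    (y : EuclideanSpace ℝ κ) :
    fderiv ℝ (fderiv ℝ fun x => (1 / 2) * ∑ e, (y e - g e x) ^ 2) x = leastSquaresSnd g x y := by
  have hev : ∀ᶠ z in 𝓝 x, ∀ e, ContDiffAt ℝ 2 (g e) z :=
    Filter.eventually_all.2 fun e => (hg e).eventually (by simp)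
  have h1 : (fderiv ℝ fun x => (1 / 2) * ∑ e, (y e - g e x) ^ 2) =ᶠ[𝓝 x]
      fun z => ∑ e, (g e z - y e) • fderiv ℝ (g e) z := by
    filter_upwards [hev] with z hz
    have h2 : HasFDerivAt (fun x => (1 / 2) * ∑ e, (y e - g e x) ^ 2) _ z :=
      (HasFDerivAt.fun_sum fun e _ =>
        ((((hz e).differentiableAt (by simp)).hasFDerivAt.const_sub (y e)).pow 2)).const_mul (1 / 2)
    rw [h2.fderiv, Finset.smul_sum]
    refine Finset.sum_congr rfl fun e _ => ?_
    ext v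
    simp
    ring
  rw [h1.fderiv_eq]
  have h3 : HasFDerivAt (fun z => ∑ e, (g e z - y e) • fderiv ℝ (g e) z) _ x :=
    HasFDerivAt.fun_sum fun e _ =>
      ((((hg e).differentiableAt (by simp)).hasFDerivAt.sub_const (y e)).smul
        (((hg e).fderiv_right (m := 1) (by norm_num)).differentiableAt (by norm_num)).hasFDerivAt)
  rw [h3.fderiv]
  rfl

/-- When y is the value of g at 0 the residuals vanish and only the sum of squared first derivatives
survives. The second derivative is jointly continuous in x and y, so a perturbation of operator norm
below C − c is affordable. -/
theorem exists_leastSquares_snd_lower_bound {g : κ → E → ℝ} (hg : ∀ e, ContDiffAt ℝ 3 (g e) 0)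
    {c C : ℝ} (hcC : c < C) (hC : ∀ h, C * ‖h‖ ^ 2 ≤ ∑ e, (fderiv ℝ (g e) 0 h) ^ 2) :
    ∃ δ > 0, ∀ x, ‖x‖ < δ → ∀ y : EuclideanSpace ℝ κ,
      ‖y - WithLp.toLp 2 fun e => g e 0‖ < δ →
      (∀ e, ContDiffAt ℝ 2 (g e) x) ∧ ∀ h, c * ‖h‖ ^ 2 ≤ leastSquaresSnd g x y h h := by
  set y₀ : EuclideanSpace ℝ κ := WithLp.toLp 2 fun e => g e 0
  have hev : ∀ᶠ z in 𝓝 (0 : E), ∀ e, ContDiffAt ℝ 2 (g e) z :=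
    Filter.eventually_all.2 fun e => ((hg e).of_le (by norm_num)).eventually (by simp)
  have hcont : ContinuousAt (fun p : E × EuclideanSpace ℝ κ => leastSquaresSnd g p.1 p.2)
      (0, y₀) := by
    have h1 (e : κ) : ContDiffAt ℝ 1 (g e) 0 := (hg e).of_le (by norm_num)
    have h2 (e : κ) : ContDiffAt ℝ 2 (fderiv ℝ (g e)) 0 :=
      (hg e).fderiv_right (by norm_num)
    have h3 (e : κ) : ContDiffAt ℝ 1 (fderiv ℝ (fderiv ℝ (g e))) 0 :=
      (h2 e).fderiv_right (by norm_num)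
    have hy (e : κ) : ContinuousAt (fun p : E × EuclideanSpace ℝ κ => p.2 e) (0, y₀) := by
      fun_prop
    unfold leastSquaresSnd
    refine tendsto_finsetSum _ fun e _ => ?_
    refine Filter.Tendsto.add (((h1 e).continuousAt.fst'.sub (hy e)).smul (h3 e).continuousAt.fst') ?_
    have h4 := (h2 e).continuousAt.fst' (y := y₀)
    exact (((ContinuousLinearMap.smulRightL ℝ E (E →L[ℝ] ℝ)).continuous.comp
      continuous_fst).clm_apply continuous_snd).continuousAt.comp
        (f := fun p : E × EuclideanSpace ℝ κ => (fderiv ℝ (g e) p.1, fderiv ℝ (g e) p.1))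
        (h4.prodMk h4)
  have hball : ∀ᶠ p in 𝓝 ((0 : E), y₀),
      dist (leastSquaresSnd g p.1 p.2) (leastSquaresSnd g 0 y₀) < C - c :=
    hcont.eventually (Metric.eventually_nhds_iff.2 ⟨C - c, sub_pos.2 hcC, fun _ h => h⟩)
  obtain ⟨δ, hδ, hb⟩ := Metric.eventually_nhds_iff.1
    (hball.and (continuousAt_fst.eventually hev))
  refine ⟨δ, hδ, fun x hx y hy => ?_⟩
  obtain ⟨h1, h2⟩ := hb (y := (x, y)) (by
    rw [Prod.dist_eq, max_lt_iff, dist_zero_right, dist_eq_norm]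
    exact ⟨hx, hy⟩)
  refine ⟨h2, fun h => ?_⟩
  rw [dist_eq_norm] at h1
  have h3 := (leastSquaresSnd g x y - leastSquaresSnd g 0 y₀).le_opNorm₂ h h
  have h4 : leastSquaresSnd g 0 y₀ h h = ∑ e, (fderiv ℝ (g e) 0 h) ^ 2 := by
    simp [leastSquaresSnd, y₀, sq]
  rw [sub_apply, sub_apply, Real.norm_eq_abs, h4] at h3
  have h5 := (abs_le.1 h3).1
  have h6 : ‖leastSquaresSnd g x y - leastSquaresSnd g 0 y₀‖ * ‖h‖ * ‖h‖ ≤ (C - c) * ‖h‖ * ‖h‖ := by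
    gcongr
  nlinarith [hC h]

/-- This invariance is why the final curvature bound does not depend on ν. -/
theorem fderiv_fderiv_scale {f : E → ℝ} {x : E} {r : ℝ} (hr : r ≠ 0) :
    fderiv ℝ (fderiv ℝ fun m => r ^ 2 * f (r⁻¹ • m)) x = fderiv ℝ (fderiv ℝ f) (r⁻¹ • x) := by
  have h1 : (fderiv ℝ fun m => r ^ 2 * f (r⁻¹ • m)) = r • fun m => fderiv ℝ f (r⁻¹ • m) := by
    refine (fderiv_const_smul_field (f := fun m => f (r⁻¹ • m)) (r ^ 2)).trans ?_
    ext1 m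
    rw [Pi.smul_apply, Pi.smul_apply, fderiv_comp_smul, smul_smul]
    congr 1
    field_simp
  rw [h1, fderiv_const_smul_field, Pi.smul_apply, fderiv_comp_smul, smul_smul, mul_inv_cancel₀ hr,
    one_smul]

end LeastSquares


/-! ### The Jacobian at zero and its Gram matrix -/

section Jacobian

/-- The expectation value of `σ^a` in the eigenvector of `σ^b`, `b ≠ 0`, with eigenvalue
`(-1)^s`. -/
def pauliExpect (a b : Fin 4) (s : Fin 2) : ℤ :=
  (if a = 0 then 1 else 0) + if a = b then (-1) ^ (s : ℕ) else 0

/-- The expectation value of `σ^a` in a product of eigenvectors of Pauli matrices. -/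
def productExpect {n : ℕ} (a β : Fin n → Fin 4) (s : Fin n → Fin 2) : ℤ :=
  ∏ j, pauliExpect (a j) (β j) (s j)

/-- The bit string `s` with its `k`th bit flipped. -/
def flipBit {n : ℕ} (k : Fin n) (s : Fin n → Fin 2) : Fin n → Fin 2 :=
  Function.update s k (s k + 1)

/-- The derivative at `0` of the gap of experiment `e` in the direction `a`. -/
def gapJacobian {n : ℕ} (e : ExpIdx n) (a : Fin n → Fin 4) : ℤ :=
  productExpect a (fun j => (e.2.2 j).1) (flipBit e.1 e.2.1) -
    productExpect a (fun j => (e.2.2 j).1) e.2.1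

/-- The factor of `gapJacobian` that belongs to one qubit; `p` tells whether it is qubit `k`. -/
def jacobianFactor (p : Prop) [Decidable p] (a b : Fin 4) (s : Fin 2) : ℤ :=
  if p then pauliExpect a b (s + 1) - pauliExpect a b s else pauliExpect a b s

/-- The sum of a product of two Jacobian factors over the settings of one qubit, on the
diagonal. -/
def jacobianWeight (p : Prop) [Decidable p] (a : Fin 4) : ℤ :=
  if p then (if a = 0 then 0 else 8) else (if a = 0 then 6 else 2)

/-- The two product expectations differ only in the factor of qubit k, so their difference still
factors. -/
theorem gapJacobian_eq_prod {n : ℕ} (e : ExpIdx n) (a : Fin n → Fin 4) :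
    gapJacobian e a = ∏ j, jacobianFactor (j = e.1) (a j) (e.2.2 j).1 (e.2.1 j) := by
  rw [gapJacobian, productExpect, productExpect, ← Finset.mul_prod_erase _ _ (Finset.mem_univ e.1),
    ← Finset.mul_prod_erase _ _ (Finset.mem_univ e.1),
    ← Finset.mul_prod_erase _ _ (Finset.mem_univ e.1)]
  have h1 : ∏ j ∈ Finset.univ.erase e.1, pauliExpect (a j) (e.2.2 j).1 (flipBit e.1 e.2.1 j) =
      ∏ j ∈ Finset.univ.erase e.1, pauliExpect (a j) (e.2.2 j).1 (e.2.1 j) :=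
    Finset.prod_congr rfl fun j hj => by
      rw [flipBit, Function.update_of_ne (Finset.ne_of_mem_erase hj)]
  have h2 : ∏ j ∈ Finset.univ.erase e.1, jacobianFactor (j = e.1) (a j) (e.2.2 j).1 (e.2.1 j) =
      ∏ j ∈ Finset.univ.erase e.1, pauliExpect (a j) (e.2.2 j).1 (e.2.1 j) :=
    Finset.prod_congr rfl fun j hj => by
      rw [jacobianFactor, if_neg (Finset.ne_of_mem_erase hj)]
  rw [h1, h2, jacobianFactor, if_pos rfl, flipBit, Function.update_self, sub_mul]

/-- One-qubit orthogonality, a finite check. Two distinct nonidentity Paulis are never both seen by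
the same β. Identity against nonidentity cancels in the sum over s, or vanishes outright on qubit k.
-/
theorem sum_jacobianFactor_mul (p : Prop) [Decidable p] (a b : Fin 4) :
    ∑ β : {b : Fin 4 // b ≠ 0}, ∑ s, jacobianFactor p a β.1 s * jacobianFactor p b β.1 s =
      if a = b then jacobianWeight p a else 0 := by
  by_cases hp : p
  · simp only [jacobianFactor, jacobianWeight, hp, if_true]
    revert a b
    decide
  · simp only [jacobianFactor, jacobianWeight, hp, if_false]
    revert a b
    decide

theorem _root_.Fintype.sum_prod_apply {ι R : Type*} {κ : Type*} [CommSemiring R] [Fintype ι]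
    [DecidableEq ι] [Fintype κ] (f : ι → κ → R) : ∑ x : ι → κ, ∏ i, f i (x i) = ∏ i, ∑ y, f i y := by
  rw [Finset.prod_univ_sum, Fintype.piFinset_univ]

/-- For fixed k the sum over (s, β) is a product of one-qubit sums, so a single qubit where a and b
differ kills it. -/
theorem sum_gapJacobian_mul {n : ℕ} (a b : Fin n → Fin 4) :
    ∑ e : ExpIdx n, gapJacobian e a * gapJacobian e b =
      if a = b then ∑ k, ∏ j, jacobianWeight (j = k) (a j) else 0 := by
  have h (k : Fin n) : ∑ q : (Fin n → Fin 2) × (Fin n → {b : Fin 4 // b ≠ 0}),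
      gapJacobian (k, q) a * gapJacobian (k, q) b =
      ∏ j, if a j = b j then jacobianWeight (j = k) (a j) else 0 := by
    rw [Fintype.sum_prod_type_right]
    simp only [gapJacobian_eq_prod, ← Finset.prod_mul_distrib]
    simp only [← sum_jacobianFactor_mul]
    rw [← Fintype.sum_prod_apply]
    refine Finset.sum_congr rfl fun β _ => ?_
    exact Fintype.sum_prod_apply fun j s =>
      jacobianFactor (j = k) (a j) (β j).1 s * jacobianFactor (j = k) (b j) (β j).1 s
  rw [Fintype.sum_prod_type]
  simp only [h]
  split_ifs with hab
  · simp [hab]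
  · obtain ⟨j, hj⟩ := Function.ne_iff.1 hab
    exact Finset.sum_eq_zero fun k _ => Finset.prod_eq_zero (Finset.mem_univ j) (if_neg hj)

theorem le_sum_prod_jacobianWeight {n : ℕ} {a : Fin n → Fin 4} (ha : a ≠ 0) :
    4 * 2 ^ n ≤ ∑ k, ∏ j, jacobianWeight (j = k) (a j) := by
  obtain ⟨k, hk⟩ := Function.ne_iff.1 ha
  have h0 (p : Prop) [Decidable p] (a : Fin 4) : 0 ≤ jacobianWeight p a := by
    unfold jacobianWeight
    split_ifs <;> norm_num
  -- Choosing k in the support of a gives weight 8 = 4·2 there and at least 2 on every other qubit.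
  have h1 : ∏ j, ((if j = k then 4 else 1) * 2 : ℤ) ≤ ∏ j, jacobianWeight (j = k) (a j) := by
    refine Finset.prod_le_prod (fun j _ => by split_ifs <;> norm_num) fun j _ => ?_
    by_cases hjk : j = k
    · subst hjk
      simp [jacobianWeight, show a j ≠ 0 from hk]
    · simp only [jacobianWeight, hjk, if_false]
      split_ifs <;> norm_num
  have h2 : ∏ j, ((if j = k then 4 else 1) * 2 : ℤ) = 4 * 2 ^ n := by
    rw [Finset.prod_mul_distrib]
    simp
  rw [← h2]
  exact h1.trans (Finset.single_le_sum (f := fun k => ∏ j, jacobianWeight (j = k) (a j))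
    (fun k _ => Finset.prod_nonneg fun j _ => h0 _ _) (Finset.mem_univ k))

theorem le_sum_sq_gapJacobian {n : ℕ} (h : Coeffs n) :
    4 * 2 ^ n * ‖h‖ ^ 2 ≤ ∑ e : ExpIdx n, (∑ a, h a * (gapJacobian e a.1 : ℝ)) ^ 2 := by
  have h1 : ∑ e : ExpIdx n, (∑ a, h a * (gapJacobian e a.1 : ℝ)) ^ 2 =
      ∑ a : CoeffIdx n, ∑ b : CoeffIdx n,
        h a * h b * ((∑ e : ExpIdx n, gapJacobian e a.1 * gapJacobian e b.1 : ℤ) : ℝ) := by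
    simp only [sq, Finset.sum_mul_sum]
    rw [Finset.sum_comm]
    refine Finset.sum_congr rfl fun a _ => ?_
    rw [Finset.sum_comm]
    refine Finset.sum_congr rfl fun b _ => ?_
    push_cast
    rw [Finset.mul_sum]
    exact Finset.sum_congr rfl fun e _ => by ring
  rw [h1, EuclideanSpace.real_norm_sq_eq, Finset.mul_sum]
  refine Finset.sum_le_sum fun a _ => ?_
  rw [Finset.sum_eq_single a]
  · rw [sum_gapJacobian_mul, if_pos rfl]
    have h2 : ((4 * 2 ^ n : ℤ) : ℝ) ≤ _ := Int.cast_le.2 (le_sum_prod_jacobianWeight a.2)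
    rw [Int.cast_mul, Int.cast_pow, Int.cast_ofNat, Int.cast_ofNat] at h2
    nlinarith [mul_le_mul_of_nonneg_left h2 (sq_nonneg (h a))]
  · intro b _ hb
    rw [sum_gapJacobian_mul, if_neg fun hab => hb (Subtype.ext hab.symm)]
    simp
  · simp

end Jacobian


/-! ### Product eigenstates and the spectrum of the control Hamiltonian -/

section ProductStates

/-- The normalized eigenvector of `σ^b`, `b ≠ 0`, with eigenvalue `(-1)^s`. -/
def pauliEigenvector (b : Fin 4) (s : Fin 2) : Fin 2 → ℂ :=
  ![![0, 0], ![(√2 : ℂ)⁻¹, (-1) ^ (s : ℕ) * (√2 : ℂ)⁻¹],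
    ![(√2 : ℂ)⁻¹, (-1) ^ (s : ℕ) * Complex.I * (√2 : ℂ)⁻¹], Pi.single s 1] b

theorem inv_sqrt_two_mul_self : (√2 : ℂ)⁻¹ * (√2 : ℂ)⁻¹ = 1 / 2 := by
  rw [← mul_inv, ← Complex.ofReal_mul, Real.mul_self_sqrt (by norm_num)]
  norm_num

theorem pauli_mulVec_pauliEigenvector {b : Fin 4} (hb : b ≠ 0) (s : Fin 2) :
    pauli b *ᵥ pauliEigenvector b s = (-1 : ℂ) ^ (s : ℕ) • pauliEigenvector b s := by
  fin_cases b
  · exact absurd rfl hb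
  all_goals
    fin_cases s <;> ext x <;> fin_cases x <;>
    simp [pauli, pauliEigenvector, Matrix.mulVec, dotProduct, Pi.single_apply, ← mul_assoc]

theorem pauliEigenvector_dotProduct {b : Fin 4} (hb : b ≠ 0) (s s' : Fin 2) :
    star (pauliEigenvector b s) ⬝ᵥ pauliEigenvector b s' = if s = s' then 1 else 0 := by
  have h2 := inv_sqrt_two_mul_self
  have hI := Complex.I_mul_I
  fin_cases b
  · exact absurd rfl hb
  all_goals
    fin_cases s <;> fin_cases s' <;>
    simp [pauliEigenvector, dotProduct, Pi.single_apply] <;>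
    grind

theorem pauliEigenvector_dotProduct_pauli {b : Fin 4} (hb : b ≠ 0) (a : Fin 4) (s : Fin 2) :
    star (pauliEigenvector b s) ⬝ᵥ (pauli a *ᵥ pauliEigenvector b s) = pauliExpect a b s := by
  have h2 := inv_sqrt_two_mul_self
  have hI := Complex.I_mul_I
  fin_cases b
  · exact absurd rfl hb
  all_goals
    fin_cases a <;> fin_cases s <;>
    simp [pauli, pauliEigenvector, pauliExpect, Matrix.mulVec, dotProduct, Pi.single_apply] <;>
    grind

variable {n : ℕ}

/-- The tensor product of single-qubit vectors. -/
def tensorVec (φ : Fin n → Fin 2 → ℂ) : EuclideanSpace ℂ (Basis n) :=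
  WithLp.toLp 2 fun x => ∏ j, φ j (x j)

theorem inner_tensorVec (φ ψ : Fin n → Fin 2 → ℂ) :
    inner ℂ (tensorVec φ) (tensorVec ψ) = ∏ j, star (φ j) ⬝ᵥ ψ j := by
  rw [EuclideanSpace.inner_eq_star_dotProduct, dotProduct_comm]
  simp only [tensorVec, dotProduct, Pi.star_apply, star_prod, ← Finset.prod_mul_distrib]
  exact Fintype.sum_prod_apply fun j x => star (φ j x) * ψ j x

theorem toEuclideanLin_pauliString_tensorVec (a : Fin n → Fin 4) (φ : Fin n → Fin 2 → ℂ) :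
    Matrix.toEuclideanLin (pauliString a) (tensorVec φ) =
      tensorVec fun j => pauli (a j) *ᵥ φ j := by
  ext x
  simp only [Matrix.toLpLin_apply, tensorVec, pauliString, Matrix.mulVec, dotProduct,
    Matrix.of_apply, ← Finset.prod_mul_distrib]
  exact Fintype.sum_prod_apply fun j y => pauli (a j) (x j) y * φ j y

theorem tensorVec_smul (c : Fin n → ℂ) (φ : Fin n → Fin 2 → ℂ) :
    (tensorVec fun j => c j • φ j) = (∏ j, c j) • tensorVec φ := by
  ext x
  simp [tensorVec, Finset.prod_mul_distrib]

/-- The product of eigenvectors of the Pauli matrices `σ^{β_j}` with eigenvalues `(-1)^{s_j}`. -/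
def productState (β : Fin n → {b : Fin 4 // b ≠ 0}) (s : Fin n → Fin 2) :
    EuclideanSpace ℂ (Basis n) :=
  tensorVec fun j => pauliEigenvector (β j).1 (s j)

theorem orthonormal_productState (β : Fin n → {b : Fin 4 // b ≠ 0}) :
    Orthonormal ℂ (productState β) := by
  rw [orthonormal_iff_ite]
  intro s s'
  rw [productState, productState, inner_tensorVec]
  simp only [pauliEigenvector_dotProduct (β _).2]
  split_ifs with h
  · simp [h]
  · obtain ⟨j, hj⟩ := Function.ne_iff.1 h
    exact Finset.prod_eq_zero (Finset.mem_univ j) (if_neg hj)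

/-- The orthonormal basis of the vectors `productState β s`. -/
def productBasis (β : Fin n → {b : Fin 4 // b ≠ 0}) :
    OrthonormalBasis (Basis n) ℂ (EuclideanSpace ℂ (Basis n)) :=
  (basisOfOrthonormalOfCardEqFinrank (orthonormal_productState β) (by simp)).toOrthonormalBasis (by
    rw [coe_basisOfOrthonormalOfCardEqFinrank]
    exact orthonormal_productState β)

theorem productBasis_apply (β : Fin n → {b : Fin 4 // b ≠ 0}) (s : Basis n) :
    productBasis β s = productState β s := by
  simp [productBasis]

theorem inner_pauliString_productState (β : Fin n → {b : Fin 4 // b ≠ 0}) (s : Fin n → Fin 2)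
    (a : Fin n → Fin 4) :
    inner ℂ (productState β s) (Matrix.toEuclideanLin (pauliString a) (productState β s)) =
      (productExpect a (fun j => (β j).1) s : ℂ) := by
  rw [productState, toEuclideanLin_pauliString_tensorVec, inner_tensorVec, productExpect]
  simp only [pauliEigenvector_dotProduct_pauli (β _).2]
  push_cast
  rfl

theorem singlePauli_productState (β : Fin n → {b : Fin 4 // b ≠ 0}) (s : Fin n → Fin 2)
    (j : Fin n) :
    Matrix.toEuclideanLin (singlePauli j (β j).1) (productState β s) =
      ((-1 : ℂ) ^ (s j : ℕ)) • productState β s := by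
  have h : (fun i => pauli ((Pi.single j (β j).1 : Fin n → Fin 4) i) *ᵥ
      pauliEigenvector (β i).1 (s i)) =
      fun i => (if i = j then (-1 : ℂ) ^ (s j : ℕ) else 1) • pauliEigenvector (β i).1 (s i) := by
    ext1 i
    by_cases hij : i = j
    · subst hij
      rw [Pi.single_eq_same, pauli_mulVec_pauliEigenvector (β i).2, if_pos rfl]
    · rw [Pi.single_eq_of_ne hij, if_neg hij, one_smul]
      have : pauli 0 = 1 := by
        ext x y
        fin_cases x <;> fin_cases y <;> simp [pauli]
      rw [this, Matrix.one_mulVec]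
  rw [singlePauli, productState, toEuclideanLin_pauliString_tensorVec, h, tensorVec_smul]
  simp

/-- The eigenvalue of the control Hamiltonian of `e` in the state `productState e.2.2 s`. -/
def ctrlEnergy (e : ExpIdx n) (s : Fin n → Fin 2) : ℝ :=
  (∑ j ∈ Finset.univ.erase e.1, (-1 : ℝ) ^ (e.2.1 j : ℕ) * (-1) ^ (s j : ℕ)) +
    1 / 2 * (-1) ^ (e.2.1 e.1 : ℕ) * (-1) ^ (s e.1 : ℕ)

theorem ctrlHamiltonian_productState (e : ExpIdx n) (s : Fin n → Fin 2) :
    Matrix.toEuclideanLin (ctrlHamiltonian e) (productState e.2.2 s) =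
      (ctrlEnergy e s : ℂ) • productState e.2.2 s := by
  simp only [ctrlHamiltonian, map_add, map_sum, map_smul, LinearMap.add_apply,
    LinearMap.sum_apply, LinearMap.smul_apply, singlePauli_productState, smul_smul]
  rw [← Finset.sum_smul, ← add_smul, ctrlEnergy]
  push_cast
  rfl

theorem neg_one_pow_mul_neg_one_pow (s s' : Fin 2) :
    (-1 : ℝ) ^ (s : ℕ) * (-1) ^ (s' : ℕ) = if s = s' then 1 else -1 := by
  fin_cases s <;> fin_cases s' <;> simp

theorem ctrlEnergy_eq (e : ExpIdx n) (s : Fin n → Fin 2) :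
    ctrlEnergy e s = (∑ j ∈ Finset.univ.erase e.1, if e.2.1 j = s j then (1 : ℝ) else -1) +
      1 / 2 * if e.2.1 e.1 = s e.1 then 1 else -1 := by
  rw [ctrlEnergy, mul_assoc]
  simp only [neg_one_pow_mul_neg_one_pow]

theorem ctrlEnergy_self (e : ExpIdx n) :
    ctrlEnergy e e.2.1 = (Finset.univ.erase e.1).card + 1 / 2 := by
  rw [ctrlEnergy_eq]
  simp

theorem ctrlEnergy_flipBit (e : ExpIdx n) :
    ctrlEnergy e (flipBit e.1 e.2.1) = (Finset.univ.erase e.1).card - 1 / 2 := by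
  rw [ctrlEnergy_eq, Finset.sum_congr rfl (g := fun _ => (1 : ℝ))]
  · simp [flipBit, sub_eq_add_neg]
  · intro j hj
    rw [flipBit, Function.update_of_ne (Finset.ne_of_mem_erase hj), if_pos rfl]

/-- The weight ½ on qubit k makes its flip the cheapest excitation. Any other s disagrees at some j
≠ k, which costs 2, while qubit k can win back at most 1. -/
theorem ctrlEnergy_lt (e : ExpIdx n) {s : Fin n → Fin 2} (h0 : s ≠ e.2.1)
    (h1 : s ≠ flipBit e.1 e.2.1) : ctrlEnergy e s < ctrlEnergy e (flipBit e.1 e.2.1) := by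
  obtain ⟨j, hj, hjs⟩ : ∃ j ∈ Finset.univ.erase e.1, e.2.1 j ≠ s j := by
    by_contra! hall
    by_cases hk : s e.1 = e.2.1 e.1
    · refine h0 (funext fun j => ?_)
      by_cases hj : j = e.1
      · rw [hj, hk]
      · exact (hall j (by simp [hj])).symm
    · refine h1 (funext fun j => ?_)
      by_cases hj : j = e.1
      · rw [hj, flipBit, Function.update_self]
        omega
      · rw [flipBit, Function.update_of_ne hj, hall j (by simp [hj])]
  have h2 : (2 : ℝ) ≤ ∑ j ∈ Finset.univ.erase e.1, (1 - if e.2.1 j = s j then (1 : ℝ) else -1) := by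
    have := Finset.single_le_sum
      (f := fun j => (1 - if e.2.1 j = s j then (1 : ℝ) else -1)) (fun i _ => by
        split_ifs <;> norm_num) hj
    rw [if_neg hjs] at this
    linarith
  rw [Finset.sum_sub_distrib] at h2
  simp only [Finset.sum_const, nsmul_eq_mul, mul_one] at h2
  rw [ctrlEnergy_flipBit, ctrlEnergy_eq]
  have h3 : (if e.2.1 e.1 = s e.1 then (1 : ℝ) else -1) ≤ 1 := by split_ifs <;> norm_num
  linarith

end ProductStates

/-- In an eigenbasis ⟨u, Tu⟩ = ∑ dᵢ |⟨bᵢ, u⟩|². If u is nonzero and orthogonal to the two lowest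
vectors, some other coefficient is nonzero, which makes the inequality strict. -/
theorem _root_.OrthonormalBasis.isLowestPair {V : Type*} [NormedAddCommGroup V]
    [InnerProductSpace ℂ V] {ι : Type*} [Fintype ι] (b : OrthonormalBasis ι ℂ V)
    {T : V →ₗ[ℂ] V} {d : ι → ℝ} (hT : ∀ i, T (b i) = (d i : ℂ) • b i) {i₀ i₁ : ι}
    (h01 : d i₀ < d i₁) (hd : ∀ i, i ≠ i₀ → i ≠ i₁ → d i₁ < d i) :
    IsLowestPair T (b i₀) (b i₁) (d i₀) (d i₁) where
  lt := h01
  left_ne := b.orthonormal.ne_zero i₀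
  right_ne := b.orthonormal.ne_zero i₁
  left := hT i₀
  right := hT i₁
  above u hu hv hw := by
    have h1 (i : ι) : inner ℂ (b i) (T u) = (d i : ℂ) * inner ℂ (b i) u := by
      conv_lhs => rw [← b.sum_repr' u]
      rw [map_sum, inner_sum, Finset.sum_eq_single i]
      · rw [map_smul, hT, inner_smul_right, inner_smul_right, inner_self_eq_norm_sq_to_K,
          b.orthonormal.1 i]
        simp [mul_comm]
      · intro j _ hj
        rw [map_smul, hT, inner_smul_right, inner_smul_right, b.orthonormal.2 hj.symm, mul_zero,
          mul_zero]
      · simp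
    have h2 : (inner ℂ u (T u)).re = ∑ i, d i * ‖(inner ℂ (b i) u : ℂ)‖ ^ 2 := by
      rw [← b.sum_inner_mul_inner, Complex.re_sum]
      refine Finset.sum_congr rfl fun i _ => ?_
      rw [h1, mul_left_comm, Complex.re_ofReal_mul, ← inner_conj_symm u (b i),
        ← Complex.normSq_eq_conj_mul_self, Complex.ofReal_re, Complex.normSq_eq_norm_sq]
    rw [h2, ← b.sum_sq_norm_inner_right u, Finset.mul_sum]
    have hle (i : ι) : d i₁ * ‖(inner ℂ (b i) u : ℂ)‖ ^ 2 ≤ d i * ‖(inner ℂ (b i) u : ℂ)‖ ^ 2 := by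
      by_cases hi0 : i = i₀
      · simp [hi0, hv]
      · by_cases hi1 : i = i₁
        · rw [hi1]
        · exact mul_le_mul_of_nonneg_right (hd i hi0 hi1).le (by positivity)
    refine Finset.sum_lt_sum (fun i _ => hle i) ?_
    obtain ⟨i, hi⟩ : ∃ i, inner ℂ (b i) u ≠ 0 := by
      by_contra! hall
      exact hu (by rw [← b.sum_repr' u]; simp [hall])
    have hi0 : i ≠ i₀ := by rintro rfl; exact hi hv
    have hi1 : i ≠ i₁ := by rintro rfl; exact hi hw
    exact ⟨i, Finset.mem_univ i, mul_lt_mul_of_pos_right (hd i hi0 hi1) (by positivity)⟩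

theorem IsLowestPair.energy_sub {m : Type*} [Fintype m] [DecidableEq m] {A : Matrix m m ℂ}
    (hA : A.IsHermitian) {v w : EuclideanSpace ℂ m} {t s : ℝ}
    (h : IsLowestPair (Matrix.toEuclideanLin A) v w t s) (h1 : 1 < Fintype.card m) :
    energy hA ⟨1, h1⟩ - energy hA ⟨0, zero_lt_one.trans h1⟩ = s - t := by
  obtain ⟨h2, h3⟩ := h.eigenvalues_eq (Matrix.isSymmetric_toEuclideanLin_iff.mpr hA)
    finrank_euclideanSpace h1
  rw [← h2, ← h3]
  rfl

/-! ### The rescaled gap as a smooth function near zero -/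

section Gap

variable {n : ℕ}

theorem hamiltonian_smul (r : ℝ) (μ : Coeffs n) :
    hamiltonian (r • μ) = (r : ℂ) • hamiltonian μ := by
  rw [hamiltonian, hamiltonian, Finset.smul_sum]
  refine Finset.sum_congr rfl fun a _ => ?_
  rw [smul_smul, ← Complex.ofReal_mul]
  rfl

/-- `μ ↦ H(μ)` as a continuous linear map into operators. -/
def hamiltonianCLM (n : ℕ) :
    Coeffs n →L[ℝ] (EuclideanSpace ℂ (Basis n) →L[ℂ] EuclideanSpace ℂ (Basis n)) :=
  LinearMap.toContinuousLinearMap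
    { toFun := fun μ => (Matrix.toEuclideanLin (hamiltonian μ)).toContinuousLinearMap
      map_add' := fun μ μ' => by
        simp [hamiltonian, add_smul, Finset.sum_add_distrib]
      map_smul' := fun r μ => by
        rw [hamiltonian_smul, map_smul, map_smul]
        rfl }

theorem hamiltonianCLM_apply (μ : Coeffs n) (v : EuclideanSpace ℂ (Basis n)) :
    hamiltonianCLM n μ v = Matrix.toEuclideanLin (hamiltonian μ) v := rfl

theorem re_inner_hamiltonianCLM_productState (μ : Coeffs n) (β : Fin n → {b : Fin 4 // b ≠ 0})
    (s : Fin n → Fin 2) :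
    (inner ℂ (productState β s) (hamiltonianCLM n μ (productState β s))).re =
      ∑ a, μ a * (productExpect a.1 (fun j => (β j).1) s : ℝ) := by
  rw [hamiltonianCLM_apply, hamiltonian]
  simp only [map_sum, map_smul, LinearMap.sum_apply, LinearMap.smul_apply, inner_sum,
    inner_smul_right, inner_pauliString_productState, Complex.re_sum, Complex.re_ofReal_mul,
    Complex.intCast_re]

/-- Perturbation theory is applied only at ν = 1, to −H_ctrl; homogeneity then covers every ν > 0 on
one neighbourhood of x = 0 that does not depend on ν. -/
theorem exists_smooth_gap (e : ExpIdx n) : ∃ g : Coeffs n → ℝ, ContDiffAt ℝ ∞ g 0 ∧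
    (∀ h, fderiv ℝ g 0 h = ∑ a, h a * (gapJacobian e a.1 : ℝ)) ∧
    ∀ᶠ x in 𝓝 0, ∀ ν : ℝ, 0 < ν → energyGap (ν • x) ν e = ν * g x := by
  let T : EuclideanSpace ℂ (Basis n) →L[ℂ] EuclideanSpace ℂ (Basis n) :=
    (Matrix.toEuclideanLin (-ctrlHamiltonian e)).toContinuousLinearMap
  have hadd (x : Coeffs n) : ((T + hamiltonianCLM n x : EuclideanSpace ℂ (Basis n) →L[ℂ] _) :
      EuclideanSpace ℂ (Basis n) →ₗ[ℂ] EuclideanSpace ℂ (Basis n)) =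
      Matrix.toEuclideanLin (totalHamiltonian x 1 e) := by
    ext1 v
    simp [T, hamiltonianCLM_apply, totalHamiltonian, neg_add_eq_sub]
  have hsymm (x : Coeffs n) := (congrArg LinearMap.IsSymmetric (hadd x)).mpr
    (Matrix.isSymmetric_toEuclideanLin_iff.mpr (totalHamiltonian_isHermitian x 1 e))
  have hpair := (productBasis e.2.2).isLowestPair (T := T) (d := fun s => -ctrlEnergy e s)
    (i₀ := e.2.1) (i₁ := flipBit e.1 e.2.1) (fun s => by
      rw [productBasis_apply]
      simp [T, ctrlHamiltonian_productState])
    (by simp only [ctrlEnergy_self, ctrlEnergy_flipBit]; linarith)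
    (fun s h0 h1 => neg_lt_neg (ctrlEnergy_lt e h0 h1))
  obtain ⟨g, hg, hdg, hgap⟩ := hpair.exists_smooth_gap hsymm
    ((productBasis e.2.2).orthonormal.1 _) ((productBasis e.2.2).orthonormal.1 _)
  refine ⟨g, hg, fun h => ?_, ?_⟩
  · rw [hdg, productBasis_apply, productBasis_apply, re_inner_hamiltonianCLM_productState,
      re_inner_hamiltonianCLM_productState, ← Finset.sum_sub_distrib]
    refine Finset.sum_congr rfl fun a _ => ?_
    rw [gapJacobian]
    push_cast
    ring
  · filter_upwards [hgap] with x ⟨v, w, t, s, hx, hgx⟩ ν hν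
    have h1 := hx.smul hν
    have h2 : (ν : ℂ) • totalHamiltonian x 1 e = totalHamiltonian (ν • x) ν e := by
      rw [totalHamiltonian, totalHamiltonian, hamiltonian_smul, smul_sub, Complex.ofReal_one,
        one_smul]
    rw [hadd, ← map_smul, h2] at h1
    rw [energyGap, h1.energy_sub, hgx]
    ring

end Gap
end HamLearn

/-! ### Choice of constants and the strong convexity bound -/

open HamLearn in
theorem propositionS1 (n : ℕ) (hn : 1 ≤ n) :
    ∃ ν₀ rl c : ℝ, 0 < ν₀ ∧ 0 < rl ∧ 0 < c ∧
      ∀ lam : HamLearn.Coeffs n, (∀ a, |lam a| ≤ 1) →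
      ∀ ν : ℝ, ν₀ ≤ ν →
      ∀ μ : HamLearn.Coeffs n, ‖μ - lam‖ ≤ rl →
      ∀ Ehat : HamLearn.Gaps n, ‖Ehat - HamLearn.gapVector lam ν‖ ≤ c * ν →
        ContDiffAt ℝ 2 (fun m : HamLearn.Coeffs n => HamLearn.loss Ehat m ν) μ ∧
        ∃ hH : (HamLearn.hessian
            (fun m : HamLearn.Coeffs n => HamLearn.loss Ehat m ν) μ).IsHermitian,
          (2 : ℝ) ^ (n - 1) ≤ HamLearn.minEigenvalue hH := by
  have hne : Nonempty (CoeffIdx n) :=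
    ⟨⟨fun _ => 1, fun h => by simpa using congrFun h ⟨0, hn⟩⟩⟩
  choose g hg hdg hgap using exists_smooth_gap (n := n)
  -- The slack between the target and the bound at the base point is what continuity spends.
  have hpow : (2 : ℝ) ^ (n - 1) < 4 * 2 ^ n := by
    have : (2 : ℝ) ^ (n - 1) ≤ 2 ^ n := pow_le_pow_right₀ (by norm_num) (Nat.sub_le n 1)
    nlinarith [pow_pos (show (0 : ℝ) < 2 by norm_num) n]
  obtain ⟨δ, hδ, hbound⟩ := exists_leastSquares_snd_lower_bound
    (fun e => (hg e).of_le ENat.LEInfty.out) hpow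
    (fun h => by simpa only [hdg] using le_sum_sq_gapJacobian h)
  set G : Coeffs n → Gaps n := fun x => WithLp.toLp 2 fun e => g e x with hG
  have hGc : ContinuousAt G 0 :=
    (PiLp.continuous_toLp 2 _).continuousAt.comp (continuousAt_pi.2 fun e => (hg e).continuousAt)
  have hnear : ∀ᶠ x in 𝓝 (0 : Coeffs n), dist (G x) (G 0) < δ / 2 ∧
      ∀ e, ∀ ν : ℝ, 0 < ν → energyGap (ν • x) ν e = ν * g e x :=
    (Metric.tendsto_nhds.1 hGc (δ / 2) (half_pos hδ)).and (Filter.eventually_all.2 hgap)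
  obtain ⟨ρ, hρ, hb⟩ := Metric.eventually_nhds_iff.1 hnear
  -- R bounds the norms of λ (entries at most 1) and of μ (at distance at most 1 from λ).
  set R : ℝ := √(Fintype.card (CoeffIdx n)) + 1 with hR
  have hRpos : 0 < R := by positivity
  set ε := min δ ρ with hε
  have hεpos : 0 < ε := lt_min hδ hρ
  -- ν > R/ε puts λ/ν and μ/ν in the ε-ball. Half of δ is allotted to the error of Ê/ν, the other
  -- half to G(λ/ν) − G(0).
  refine ⟨R / ε + 1, 1, δ / 2, by positivity, one_pos, half_pos hδ, ?_⟩
  intro lam hlam ν hν μ hμ Ehat hE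
  have hνε : R / ε < ν := by linarith
  have hνpos : 0 < ν := lt_trans (by positivity) hνε
  have hscale {x : Coeffs n} (hx : ‖x‖ ≤ R) : ‖ν⁻¹ • x‖ < ε := by
    rw [norm_smul, norm_inv, Real.norm_of_nonneg hνpos.le, inv_mul_lt_iff₀ hνpos]
    exact hx.trans_lt ((div_lt_iff₀ hεpos).1 hνε)
  have hlamR : ‖lam‖ ≤ √(Fintype.card (CoeffIdx n)) := by
    rw [EuclideanSpace.norm_eq]
    refine Real.sqrt_le_sqrt ?_
    calc ∑ a, ‖lam a‖ ^ 2 ≤ ∑ a : CoeffIdx n, (1 : ℝ) :=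
          Finset.sum_le_sum fun a _ => pow_le_one₀ (norm_nonneg _) (hlam a)
      _ = _ := by simp
  have hlamε := hscale (hlamR.trans (by linarith : _ ≤ R))
  have hμε : ‖ν⁻¹ • μ‖ < ε := hscale (by
    have := norm_add_le (μ - lam) lam
    rw [sub_add_cancel] at this
    linarith)
  have hvec {x : Coeffs n} (hx : ‖ν⁻¹ • x‖ < ε) : gapVector x ν = ν • G (ν⁻¹ • x) := by
    have h1 := (hb (y := ν⁻¹ • x) (by
      rw [dist_zero_right]; exact hx.trans_le (min_le_right _ _))).2
    ext e
    have h2 := h1 e ν hνpos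
    rw [smul_smul, mul_inv_cancel₀ hνpos.ne', one_smul] at h2
    exact h2
  have hloss : (fun m => loss Ehat m ν) =ᶠ[𝓝 μ] fun m =>
      ν ^ 2 * ((1 / 2) * ∑ e, ((ν⁻¹ • Ehat) e - g e (ν⁻¹ • m)) ^ 2) := by
    -- Derivatives at μ need the rescaled formula on a neighbourhood of μ, available because the
    -- ball is open.
    have hmem : ∀ᶠ m in 𝓝 μ, ‖ν⁻¹ • m‖ < ε :=
      (continuous_const_smul ν⁻¹).norm.continuousAt.eventually_lt continuousAt_const hμε
    filter_upwards [hmem] with m hm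
    have h1 : Ehat - ν • G (ν⁻¹ • m) = ν • (ν⁻¹ • Ehat - G (ν⁻¹ • m)) := by
      rw [smul_sub, smul_smul, mul_inv_cancel₀ hνpos.ne', one_smul]
    rw [loss, hvec hm, h1, norm_smul, mul_pow, EuclideanSpace.real_norm_sq_eq, Real.norm_eq_abs,
      sq_abs, mul_left_comm]
    rfl
  have hy : ‖ν⁻¹ • Ehat - G 0‖ < δ := by
    have h1 : ν⁻¹ • Ehat - G 0 =
        ν⁻¹ • (Ehat - gapVector lam ν) + (G (ν⁻¹ • lam) - G 0) := by
      rw [hvec hlamε, smul_sub, smul_smul, inv_mul_cancel₀ hνpos.ne', one_smul]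
      abel
    have h2 := (hb (y := ν⁻¹ • lam) (by
      rw [dist_zero_right]; exact hlamε.trans_le (min_le_right _ _))).1
    rw [dist_eq_norm] at h2
    have h3 : ‖ν⁻¹ • (Ehat - gapVector lam ν)‖ ≤ δ / 2 := by
      rw [norm_smul, norm_inv, Real.norm_of_nonneg hνpos.le, inv_mul_le_iff₀ hνpos]
      linarith
    rw [h1]
    linarith [norm_add_le (ν⁻¹ • (Ehat - gapVector lam ν)) (G (ν⁻¹ • lam) - G 0)]
  obtain ⟨hsmooth, hpos⟩ := hbound (ν⁻¹ • μ) (hμε.trans_le (min_le_left _ _)) (ν⁻¹ • Ehat) hy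
  have hCD : ContDiffAt ℝ 2 (fun m : Coeffs n => loss Ehat m ν) μ := by
    refine ContDiffAt.congr_of_eventuallyEq ?_ hloss
    refine contDiffAt_const.mul (contDiffAt_const.mul (ContDiffAt.sum fun e _ => ?_))
    refine (contDiffAt_const.sub ?_).pow 2
    exact ContDiffAt.comp μ (hsmooth e) (contDiff_const_smul ν⁻¹).contDiffAt
  refine ⟨hCD, hessian_isHermitian hCD, le_minEigenvalue_hessian hCD fun h => ?_⟩
  have h1 : fderiv ℝ (fderiv ℝ fun m : Coeffs n => loss Ehat m ν) μ =
      leastSquaresSnd g (ν⁻¹ • μ) (ν⁻¹ • Ehat) := by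
    rw [hloss.fderiv.fderiv_eq,
      fderiv_fderiv_scale (f := fun x => (1 / 2) * ∑ e, ((ν⁻¹ • Ehat) e - g e x) ^ 2) hνpos.ne',
      leastSquares_fderiv_fderiv hsmooth]
  rw [h1]
  exact hpos h

end
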